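/- Let $\mathbb{R}^\infty$ (respectively $\mathbb{Z}^\infty$) be the set of sequences $u=(u_1,u_2,\dots)$ of real numbers (respectively integers) with only finitely many nonzero entries, and let $\mathbb{R}^\infty_{\ge 0}\subseteq\mathbb{R}^\infty$ be the set of those with all entries nonnegative. Let $\mathrm{Sym}=\mathrm{Sym}(\infty)$ be the group of permutations of $\mathbb{N}=\{1,2,\dots\}$ that fix all but finitely many elements, acting on sequences by $\sigma(u)=(u_{\sigma^{-1}(1)},u_{\sigma^{-1}(2)},\dots)$, and for a set $A$ of sequences put $\mathrm{Sym}(A)=\{\sigma(u)\mid \sigma\in\mathrm{Sym},\ u\in A\}$. A cone $C\subseteq\mathbb{R}^\infty$ is called rational if it is generated, as a cone, by (possibly infinitely many) elements with rational coordinates. It is called $\mathrm{Sym}$-equivariantly finitely generated if there is a finite set $A\subseteq\mathbb{R}^\infty$ such that $C$ is the cone generated by $\mathrm{Sym}(A)$, i.e. the set of all finite linear combinations of elements of $\mathrm{Sym}(A)$ with nonnegative real coefficients. A monoid (additive submonoid) $M\subseteq\mathbb{Z}^\infty$ is called $\mathrm{Sym}$-equivariantly finitely generated if there is a finite set $A\subseteq\mathbb{Z}^\infty$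 such that $M$ is the monoid generated by $\mathrm{Sym}(A)$. The monoid $M$ is called normal if $M=\{u\in\mathbb{Z}^{\mathbb{N}}\mid ku\in M\text{ for some integer }k\ge 1\}$. **Theorem (equivariant Gordan's lemma).** Let $C\subseteq\mathbb{R}^\infty_{\ge 0}$ be a $\mathrm{Sym}$-equivariantly finitely generated rational cone. Then $M=C\cap\mathbb{Z}^\infty$ is a $\mathrm{Sym}$-equivariantly finitely generated normal monoid. -/

import Mathlib

/-- `Sym(∞)`: the group of permutations of the index set that fix all but finitely many indices.
(Coordinates are indexed by `ℕ`, starting from `0`.) -/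
def SymInf : Subgroup (Equiv.Perm ℕ) where
  carrier := {σ | {i | σ i ≠ i}.Finite}
  one_mem' := by simp
  mul_mem' := by
    intro σ τ hσ hτ
    refine (Set.Finite.union hσ hτ).subset fun i hi => ?_
    by_contra h
    simp only [Set.mem_union, Set.mem_ofPred_eq, not_or, not_not] at h
    exact hi (by rw [Equiv.Perm.mul_apply, h.2, h.1])
  inv_mem' := by
    intro σ hσ
    refine Set.Finite.subset hσ fun i hi h => hi ?_
    rw [Equiv.Perm.inv_eq_iff_eq, h]

/-- `R^∞`: the sequences in `R^ℕ` of finite support. -/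
def FinSuppSeq (R : Type*) [AddMonoid R] : AddSubmonoid (ℕ → R) where
  carrier := {u | (Function.support u).Finite}
  zero_mem' := by simp
  add_mem' := fun hu hv => (Set.Finite.union hu hv).subset (Function.support_add _ _)

/-- The action `σ(u) = (u_{σ⁻¹(i)})_i` of permutations on sequences. -/
def permSeq {R : Type*} (σ : Equiv.Perm ℕ) (u : ℕ → R) : ℕ → R := fun i => u (σ⁻¹ i)

/-- `Sym(A) = {σ(u) | σ ∈ Sym(∞), u ∈ A}`. -/
def symOrbit {R : Type*} (A : Set (ℕ → R)) : Set (ℕ → R) :=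
  {v | ∃ σ ∈ SymInf, ∃ u ∈ A, v = permSeq σ u}

/-- A cone is `Sym`-equivariantly finitely generated if it is the cone generated by `Sym(A)` for
some finite set `A ⊆ ℝ^∞`. -/
def ConeSymFG (C : PointedCone ℝ (ℕ → ℝ)) : Prop :=
  ∃ A : Set (ℕ → ℝ), A.Finite ∧ A ⊆ FinSuppSeq ℝ ∧ C = PointedCone.hull ℝ (symOrbit A)

/-- A cone is rational if it is generated by elements with rational coordinates. -/
def ConeRational (C : PointedCone ℝ (ℕ → ℝ)) : Prop :=
  ∃ B : Set (ℕ → ℝ), (∀ b ∈ B, ∀ i, ∃ q : ℚ, b i = (q : ℝ)) ∧ C = PointedCone.hull ℝ B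

/-- A monoid in `ℤ^ℕ` is `Sym`-equivariantly finitely generated if it is the monoid generated by
`Sym(A)` for some finite set `A ⊆ ℤ^∞`. -/
def MonoidSymFG (M : AddSubmonoid (ℕ → ℤ)) : Prop :=
  ∃ A : Set (ℕ → ℤ), A.Finite ∧ A ⊆ FinSuppSeq ℤ ∧ M = AddSubmonoid.closure (symOrbit A)

/-- The normalization `{u ∈ ℤ^ℕ | k u ∈ M for some integer k ≥ 1}` of a monoid `M ⊆ ℤ^ℕ`. -/
def normalization (M : AddSubmonoid (ℕ → ℤ)) : Set (ℕ → ℤ) :=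
  {u | ∃ k : ℕ, 1 ≤ k ∧ k • u ∈ M}

/-- A monoid `M ⊆ ℤ^ℕ` is normal if it equals its normalization. -/
def MonoidNormal (M : AddSubmonoid (ℕ → ℤ)) : Prop :=
  (M : Set (ℕ → ℤ)) = normalization M

/-- The inclusion of `ℤ^ℕ` into `ℝ^ℕ`. -/
def intSeqToReal : (ℕ → ℤ) →+ (ℕ → ℝ) where
  toFun u := fun i => (u i : ℝ)
  map_zero' := by ext; simp
  map_add' := by intros; ext; simp

/-- The monoid `C ∩ ℤ^∞`. -/
def latticePoints (C : PointedCone ℝ (ℕ → ℝ)) : AddSubmonoid (ℕ → ℤ) :=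
  C.toAddSubmonoid.comap intSeqToReal ⊓ FinSuppSeq ℤ

/-! Rationality lets `C` be generated by the orbit of finitely many nonnegative integer vectors,
whose coordinate sums are at most some `m`. It then suffices to generate the lattice points by those
of coordinate sum at most some `L`: the latter form finitely many orbits.

This goes by induction on the support of `u`. For support at most `7 * m`, the classical Gordan
argument applies, splitting coefficients into integer and fractional parts
(`mem_closure_of_card_support_le`). For larger support, `exists_merge_mem_hull` moves all of a
minimal entry `u j` onto some entry `u i` inside the cone, so the result `v` is generated by
induction. Then `unmerge_mem_closure` recovers `u` from `v` by unit transfers from `i` back to `j`;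
each acts on a single generator and preserves its coordinate sum, so `L` does not grow. -/

/-! ### Merging two coordinates inside the cone -/

/-- Selection step: from a matrix of overlaps with small row sums and small column `j`, find an
index `i` that overlaps little with `j` and with most indices. -/
theorem exists_index_small_overlap (F : Finset ℕ) (W : ℕ → ℕ → ℝ) (u : ℕ → ℝ) (m : ℕ) (j : ℕ)
    (hj : j ∈ F) (hF : 7 * m < F.card) (hW : ∀ l i, 0 ≤ W l i) (hu : ∀ l ∈ F, 0 < u l)
    (hmin : ∀ l ∈ F, u j ≤ u l) (hrow : ∀ l ∈ F, ∑ i ∈ F, W l i ≤ m * u l)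
    (hcol : ∑ l ∈ F, W l j ≤ m * u j) :
    ∃ i ∈ F, W j i ≤ u j / 2 ∧ m < (F.filter fun l => W l i + W l j ≤ u l / 2).card := by
  have hn : (7 * m : ℝ) + 1 ≤ F.card := by exact_mod_cast hF
  have hn0 : (0 : ℝ) < F.card := by
    have : (0 : ℝ) ≤ m := Nat.cast_nonneg m
    linarith
  have hrow' : ∀ l ∈ F, ∑ i ∈ F, W l i / u l ≤ m := fun l hl => by
    rw [← Finset.sum_div, div_le_iff₀ (hu l hl)]
    exact hrow l hl
  -- Both requirements on `i` are averaged at once; the weight `F.card` makes the two terms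
  -- contribute equally.
  have hsum : ∑ i ∈ F, (F.card * (W j i / u j) + ∑ l ∈ F, W l i / u l) ≤
      ∑ _i ∈ F, (2 * m : ℝ) := by
    rw [Finset.sum_add_distrib, ← Finset.mul_sum, Finset.sum_comm, Finset.sum_const, nsmul_eq_mul]
    have h1 := mul_le_mul_of_nonneg_left (hrow' j hj) hn0.le
    have h2 := Finset.sum_le_sum hrow'
    rw [Finset.sum_const, nsmul_eq_mul] at h2
    linarith
  obtain ⟨i, hi, hgi⟩ := Finset.exists_le_of_sum_le ⟨j, hj⟩ hsum
  have hratio : ∀ l ∈ F, ∀ i, 0 ≤ W l i / u l := fun l hl i => div_nonneg (hW l i) (hu l hl).le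
  have hs0 : 0 ≤ ∑ l ∈ F, W l i / u l := Finset.sum_nonneg fun l hl => hratio l hl i
  refine ⟨i, hi, ?_, ?_⟩
  · have h1 : (F.card : ℝ) * (W j i / u j) ≤ 2 * m := by linarith
    have h2 : W j i / u j ≤ 1 / 2 := by
      by_contra! h
      nlinarith
    rw [div_le_iff₀ (hu j hj)] at h2
    linarith
  · have h1 : ∑ l ∈ F, W l i / u l ≤ 2 * m := by
      have := mul_nonneg hn0.le (hratio j hj i)
      linarith
    have h2 : ∑ l ∈ F, W l j / u l ≤ m := by
      calc ∑ l ∈ F, W l j / u l ≤ ∑ l ∈ F, W l j / u j :=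
            Finset.sum_le_sum fun l hl =>
              div_le_div_of_nonneg_left (hW l j) (hu j hj) (hmin l hl)
        _ ≤ m := by rw [← Finset.sum_div, div_le_iff₀ (hu j hj)]; exact hcol
    -- Markov's inequality: at most `6 * m` indices are bad, so `7 * m < F.card` leaves more than
    -- `m` good ones.
    have h3 : ((F.filter fun l => ¬ W l i + W l j ≤ u l / 2).card : ℝ) * (1 / 2) ≤ 3 * m := by
      calc _ = (F.filter fun l => ¬ W l i + W l j ≤ u l / 2).card • (1 / 2 : ℝ) := by
            rw [nsmul_eq_mul]
        _ ≤ ∑ l ∈ F.filter fun l => ¬ W l i + W l j ≤ u l / 2, (W l i / u l + W l j / u l) := by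
            refine Finset.card_nsmul_le_sum _ _ _ fun l hl => ?_
            obtain ⟨hl, hlt⟩ := Finset.mem_filter.1 hl
            rw [← add_div, le_div_iff₀ (hu l hl)]
            linarith
        _ ≤ ∑ l ∈ F, (W l i / u l + W l j / u l) :=
            Finset.sum_le_sum_of_subset_of_nonneg (Finset.filter_subset _ _) fun l hl _ =>
              add_nonneg (hratio l hl i) (hratio l hl j)
        _ ≤ 3 * m := by rw [Finset.sum_add_distrib]; linarith
    have h4 : ((F.filter fun l => W l i + W l j ≤ u l / 2).card : ℝ) +
        (F.filter fun l => ¬ W l i + W l j ≤ u l / 2).card = F.card := by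
      exact_mod_cast Finset.card_filter_add_card_filter_not (s := F) _
    have h5 : (m : ℝ) < (F.filter fun l => W l i + W l j ≤ u l / 2).card := by linarith
    exact_mod_cast h5

theorem PointedCone.mem_hull_iff_exists_finset {S : Set (ℕ → ℝ)} {u : ℕ → ℝ} :
    u ∈ PointedCone.hull ℝ S ↔ ∃ (T : Finset (ℕ → ℝ)) (lam : (ℕ → ℝ) → ℝ),
      (∀ x ∈ T, x ∈ S) ∧ (∀ x, 0 ≤ lam x) ∧ ∑ x ∈ T, lam x • x = u := by
  rw [PointedCone.mem_hull_set]
  constructor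
  · rintro ⟨c, hc, h0, rfl⟩
    exact ⟨c.support, c, fun x hx => hc hx, h0, rfl⟩
  · rintro ⟨T, lam, hT, h0, rfl⟩
    rw [← PointedCone.mem_hull_set]
    exact sum_mem fun x hx =>
      (PointedCone.hull ℝ S).smul_mem (h0 x) (Submodule.subset_span (hT x hx))

/-- Generators with natural number entries and bounded sums. -/
structure BoundedNatVectors (S : Set (ℕ → ℝ)) (m : ℕ) : Prop where
  nat : ∀ x ∈ S, ∀ i, ∃ n : ℕ, x i = n
  sum_le : ∀ x ∈ S, ∀ F : Finset ℕ, ∑ i ∈ F, x i ≤ m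

namespace BoundedNatVectors

variable {S : Set (ℕ → ℝ)} {m : ℕ}

theorem nonneg (hS : BoundedNatVectors S m) {x : ℕ → ℝ} (hx : x ∈ S) (i : ℕ) : 0 ≤ x i := by
  obtain ⟨n, hn⟩ := hS.nat x hx i
  rw [hn]; exact Nat.cast_nonneg n

theorem one_le (hS : BoundedNatVectors S m) {x : ℕ → ℝ} (hx : x ∈ S) {i : ℕ} (hi : x i ≠ 0) : 1 ≤ x i := by
  obtain ⟨n, hn⟩ := hS.nat x hx i
  rw [hn] at hi ⊢
  exact_mod_cast Nat.one_le_iff_ne_zero.2 (by exact_mod_cast hi)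

theorem card_le (hS : BoundedNatVectors S m) {x : ℕ → ℝ} (hx : x ∈ S) (F : Finset ℕ) :
    (F.filter fun i => x i ≠ 0).card ≤ m := by
  have h : ((F.filter fun i => x i ≠ 0).card : ℝ) ≤ m := by
    calc _ = ∑ i ∈ F.filter fun i => x i ≠ 0, (1 : ℝ) := by simp
      _ ≤ ∑ i ∈ F.filter fun i => x i ≠ 0, x i :=
        Finset.sum_le_sum fun i hi => hS.one_le hx (Finset.mem_filter.1 hi).2
      _ ≤ m := hS.sum_le x hx _
  exact_mod_cast h

end BoundedNatVectors

/-- Merging coordinates: if `u` lies in the cone generated by `S` and has large support, then some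
minimal positive coordinate of `u` can be moved onto another coordinate without leaving the
cone. -/
theorem exists_merge_mem_hull {S : Set (ℕ → ℝ)} {m : ℕ} (hS : BoundedNatVectors S m)
    (hmove : ∀ x ∈ S, ∀ i j, x i = 0 →
      x + x j • (Pi.single i (1 : ℝ) - Pi.single j 1) ∈ PointedCone.hull ℝ S)
    {u : ℕ → ℝ} (hu : u ∈ PointedCone.hull ℝ S) (F : Finset ℕ) (hupos : ∀ l ∈ F, 0 < u l)
    (hF : 7 * m < F.card) :
    ∃ i ∈ F, ∃ j ∈ F, i ≠ j ∧ u j ≤ u i ∧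
      u + u j • (Pi.single i (1 : ℝ) - Pi.single j 1) ∈ PointedCone.hull ℝ S := by
  obtain ⟨T, lam, hT, hlam, hsum⟩ := PointedCone.mem_hull_iff_exists_finset.1 hu
  have huc : ∀ l, u l = ∑ x ∈ T, lam x * x l := fun l => by
    rw [← hsum, Finset.sum_apply]; rfl
  have hx0 : ∀ x ∈ T, ∀ i, 0 ≤ x i := fun x hx => hS.nonneg (hT x hx)
  have hterm : ∀ x ∈ T, ∀ i, 0 ≤ lam x * x i := fun x hx i => mul_nonneg (hlam x) (hx0 x hx i)
  obtain ⟨j, hj, hmin⟩ := F.exists_min_image u (Finset.card_pos.1 (by omega))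
  -- `W l i` is the part of `u l` carried by generators that are nonzero at `i`.
  set W : ℕ → ℕ → ℝ := fun l i => ∑ x ∈ T with x i ≠ 0, lam x * x l with hWdef
  have hW0 : ∀ l i, 0 ≤ W l i := fun l i =>
    Finset.sum_nonneg fun x hx => hterm x (Finset.mem_filter.1 hx).1 l
  have hrow : ∀ l ∈ F, ∑ i ∈ F, W l i ≤ m * u l := by
    intro l _
    simp only [hWdef, Finset.sum_filter]
    rw [Finset.sum_comm, huc, Finset.mul_sum]
    refine Finset.sum_le_sum fun x hx => ?_
    rw [← Finset.sum_filter, Finset.sum_const, nsmul_eq_mul]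
    exact mul_le_mul_of_nonneg_right (by exact_mod_cast hS.card_le (hT x hx) F) (hterm x hx l)
  have hcol : ∑ l ∈ F, W l j ≤ m * u j := by
    simp only [hWdef]
    rw [Finset.sum_comm, huc, Finset.mul_sum, Finset.sum_filter]
    refine Finset.sum_le_sum fun x hx => ?_
    split_ifs with hxj
    · rw [← Finset.mul_sum]
      have h1 := mul_le_mul_of_nonneg_left (hS.sum_le x (hT x hx) F) (hlam x)
      have h2 := mul_le_mul_of_nonneg_left (hS.one_le (hT x hx) hxj) (mul_nonneg (hlam x)
        (Nat.cast_nonneg (α := ℝ) m))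
      linarith
    · exact mul_nonneg (Nat.cast_nonneg m) (hterm x hx j)
  obtain ⟨i, hi, hWji, hL⟩ := exists_index_small_overlap F W u m j hj hF hW0 hupos hmin hrow hcol
  have huj := hupos j hj
  have hij : i ≠ j := by
    rintro rfl
    have : W i i = u i := by
      change ∑ x ∈ T with x i ≠ 0, lam x * x i = u i
      rw [huc, Finset.sum_filter]
      refine Finset.sum_congr rfl fun x _ => ?_
      by_cases h : x i = 0 <;> simp [h]
    linarith
  refine ⟨i, hi, j, hj, hij, hmin i hi, ?_⟩
  set L := F.filter fun l => W l i + W l j ≤ u l / 2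
  -- A generator has at most `m` nonzero entries, so it vanishes somewhere on `L`.
  have hell : ∀ x, ∃ l, x ∈ T → l ∈ L ∧ x l = 0 := by
    intro x
    by_cases hx : x ∈ T
    · by_contra! h
      have := hS.card_le (hT x hx) L
      rw [Finset.filter_true_of_mem fun l hl => (h l).2 hl] at this
      omega
    · exact ⟨0, fun h => absurd h hx⟩
  choose ell hellL using hell
  -- Generators in `J` move their `j`-entry straight to `i`. Those in `B` already occupy `i`, so
  -- they move it to a free place `ell x`; generators in `N`, which avoid both `i` and `j`, then
  -- carry the same mass from `ell x` to `i`. Those in `Ti` stay fixed.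
  set Tj := T.filter fun x => x j ≠ 0
  set N := (T.filter fun x => ¬ x j ≠ 0).filter fun x => x i = 0 with hN
  set Ti := (T.filter fun x => ¬ x j ≠ 0).filter fun x => ¬ x i = 0
  set J := Tj.filter fun x => x i = 0
  set B := Tj.filter fun x => ¬ x i = 0 with hB
  have hBT : ∀ x ∈ B, x ∈ T := fun x hx => (Finset.mem_filter.1 (Finset.mem_filter.1 hx).1).1
  have hJT : ∀ x ∈ J, x ∈ T := fun x hx => (Finset.mem_filter.1 (Finset.mem_filter.1 hx).1).1
  have hNT : ∀ x ∈ N, x ∈ T := fun x hx => (Finset.mem_filter.1 (Finset.mem_filter.1 hx).1).1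
  have hTiT : ∀ x ∈ Ti, x ∈ T := fun x hx => (Finset.mem_filter.1 (Finset.mem_filter.1 hx).1).1
  have hsplit : ∀ {E : Type} [AddCommMonoid E] (f : (ℕ → ℝ) → E),
      ∑ x ∈ T, f x = (∑ x ∈ J, f x + ∑ x ∈ B, f x) + (∑ x ∈ N, f x + ∑ x ∈ Ti, f x) := by
    intro E _ f
    rw [Finset.sum_filter_add_sum_filter_not, Finset.sum_filter_add_sum_filter_not,
      Finset.sum_filter_add_sum_filter_not]
  set v : ℕ → ℝ := fun l => ∑ x ∈ N, lam x * x l with hv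
  have hvL : ∀ l ∈ L, u j / 2 ≤ v l := by
    intro l hl
    obtain ⟨hlF, hl⟩ := Finset.mem_filter.1 hl
    have h1 : u l ≤ v l + (W l i + W l j) := by
      rw [huc, hv, hWdef, hN, Finset.filter_filter]
      simp only [Finset.sum_filter]
      rw [← Finset.sum_add_distrib, ← Finset.sum_add_distrib]
      refine Finset.sum_le_sum fun x hx => ?_
      have := hterm x hx l
      by_cases h1 : x i = 0 <;> by_cases h2 : x j = 0 <;> simp [h1, h2, this]
    have := hmin l hlF
    linarith
  have hBj : ∑ z ∈ B, lam z * z j = W j i := by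
    rw [hWdef, hB, Finset.filter_filter]
    simp only [Finset.sum_filter]
    refine Finset.sum_congr rfl fun x _ => ?_
    by_cases h1 : x i = 0 <;> by_cases h2 : x j = 0 <;> simp [h1, h2]
  -- The fraction of `N` that must be moved from `ell z` to `i` to compensate for `z`. The fractions
  -- sum to at most 1 because `B` carries at most `u j / 2` at `j`, while `N` carries at least that
  -- much at each index of `L`.
  set θ : (ℕ → ℝ) → ℝ := fun z => lam z * z j / v (ell z) with hθ
  have hvpos : ∀ z ∈ B, 0 < v (ell z) := fun z hz =>
    (half_pos huj).trans_le (hvL _ (hellL z (hBT z hz)).1)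
  have hθ0 : ∀ z ∈ B, 0 ≤ θ z := fun z hz =>
    div_nonneg (hterm z (hBT z hz) j) (hvpos z hz).le
  have hθ1 : ∑ z ∈ B, θ z ≤ 1 := by
    calc ∑ z ∈ B, θ z ≤ ∑ z ∈ B, lam z * z j / (u j / 2) :=
          Finset.sum_le_sum fun z hz => div_le_div_of_nonneg_left (hterm z (hBT z hz) j)
            (half_pos huj) (hvL _ (hellL z (hBT z hz)).1)
      _ ≤ 1 := by rw [← Finset.sum_div, hBj, div_le_one (half_pos huj)]; exact hWji
  set e : ℕ → ℕ → ℝ := fun l => Pi.single l 1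
  have hgen : ∀ x ∈ T, x ∈ PointedCone.hull ℝ S := fun x hx => Submodule.subset_span (hT x hx)
  have hJmem : ∑ x ∈ J, lam x • (x + x j • (e i - e j)) ∈ PointedCone.hull ℝ S :=
    sum_mem fun x hx => (PointedCone.hull ℝ S).smul_mem (hlam x)
      (hmove x (hT x (hJT x hx)) i j (Finset.mem_filter.1 hx).2)
  have hBmem : ∑ x ∈ B, lam x • (x + x j • (e (ell x) - e j)) ∈ PointedCone.hull ℝ S :=
    sum_mem fun x hx => (PointedCone.hull ℝ S).smul_mem (hlam x)
      (hmove x (hT x (hBT x hx)) (ell x) j (hellL x (hBT x hx)).2)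
  have hTimem : ∑ x ∈ Ti, lam x • x ∈ PointedCone.hull ℝ S :=
    sum_mem fun x hx => (PointedCone.hull ℝ S).smul_mem (hlam x) (hgen x (hTiT x hx))
  have hNmem : ∑ x ∈ N, lam x • (x + ∑ z ∈ B, θ z • x (ell z) • (e i - e (ell z))) ∈
      PointedCone.hull ℝ S := by
    refine sum_mem fun x hx => (PointedCone.hull ℝ S).smul_mem (hlam x) ?_
    have : x + ∑ z ∈ B, θ z • x (ell z) • (e i - e (ell z)) =
        (1 - ∑ z ∈ B, θ z) • x + ∑ z ∈ B, θ z • (x + x (ell z) • (e i - e (ell z))) := by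
      simp only [smul_add, Finset.sum_add_distrib, sub_smul, one_smul, Finset.sum_smul]
      abel
    rw [this]
    exact add_mem ((PointedCone.hull ℝ S).smul_mem (by linarith) (hgen x (hNT x hx)))
      (sum_mem fun z hz => (PointedCone.hull ℝ S).smul_mem (hθ0 z hz)
        (hmove x (hT x (hNT x hx)) i (ell z) (Finset.mem_filter.1 hx).2))
  have hNsum : ∑ x ∈ N, lam x • ∑ z ∈ B, θ z • x (ell z) • (e i - e (ell z)) =
      ∑ z ∈ B, (lam z * z j) • (e i - e (ell z)) := by
    simp only [Finset.smul_sum]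
    rw [Finset.sum_comm]
    refine Finset.sum_congr rfl fun z hz => ?_
    have h1 : θ z * v (ell z) = lam z * z j := div_mul_cancel₀ _ (hvpos z hz).ne'
    rw [← h1, hv, Finset.mul_sum, Finset.sum_smul]
    refine Finset.sum_congr rfl fun x _ => ?_
    rw [smul_smul, smul_smul]
    congr 1
    ring
  have hTj : u j = ∑ x ∈ J, lam x * x j + ∑ x ∈ B, lam x * x j := by
    rw [huc, Finset.sum_filter_add_sum_filter_not, Finset.sum_filter]
    refine Finset.sum_congr rfl fun x _ => ?_
    by_cases h : x j = 0 <;> simp [h]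
  have hfinal : u + u j • (e i - e j) =
      (∑ x ∈ J, lam x • (x + x j • (e i - e j)) +
        ∑ x ∈ B, lam x • (x + x j • (e (ell x) - e j))) +
      (∑ x ∈ N, lam x • (x + ∑ z ∈ B, θ z • x (ell z) • (e i - e (ell z))) +
        ∑ x ∈ Ti, lam x • x) := by
    have hB2 : ∑ x ∈ B, (lam x * x j) • (e i - e j) =
        ∑ x ∈ B, (lam x * x j) • (e (ell x) - e j) +
          ∑ x ∈ B, (lam x * x j) • (e i - e (ell x)) := by
      rw [← Finset.sum_add_distrib]
      refine Finset.sum_congr rfl fun x _ => ?_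
      rw [← smul_add]
      congr 1
      abel
    conv_lhs => rw [hTj, ← hsum, hsplit, add_smul, Finset.sum_smul, Finset.sum_smul, hB2]
    simp only [smul_add, Finset.sum_add_distrib, hNsum]
    simp only [smul_smul]
    abel
  rw [hfinal]
  exact add_mem (add_mem hJmem hBmem) (add_mem hNmem hTimem)

/-! ### The symmetric group action on cones -/

theorem permSeq_swap (u : ℕ → ℝ) (i j : ℕ) :
    permSeq (Equiv.swap i j) u = u + (u i - u j) • (Pi.single j (1 : ℝ) - Pi.single i 1) := by
  ext l
  by_cases hij : i = j
  · subst hij; simp [permSeq]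
  by_cases hi : l = i
  · subst hi; simp [permSeq, hij]
  by_cases hj : l = j
  · subst hj; simp [permSeq, hi]
  simp [permSeq, Equiv.swap_apply_of_ne_of_ne hi hj, hi, hj]

theorem swap_mem_symInf (i j : ℕ) : Equiv.swap i j ∈ SymInf := by
  refine (Set.toFinite {i, j}).subset fun l hl => ?_
  by_contra h
  simp only [Set.mem_insert_iff, Set.mem_singleton_iff, not_or] at h
  exact hl (Equiv.swap_apply_of_ne_of_ne h.1 h.2)

theorem permSeq_permSeq {R : Type*} (σ τ : Equiv.Perm ℕ) (u : ℕ → R) :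
    permSeq σ (permSeq τ u) = permSeq (σ * τ) u := by
  ext i; simp [permSeq]

theorem permSeq_mem_symOrbit {R : Type*} {A : Set (ℕ → R)} {σ : Equiv.Perm ℕ} (hσ : σ ∈ SymInf)
    {u : ℕ → R} (hu : u ∈ symOrbit A) : permSeq σ u ∈ symOrbit A := by
  obtain ⟨τ, hτ, a, ha, rfl⟩ := hu
  exact ⟨σ * τ, mul_mem hσ hτ, a, ha, permSeq_permSeq σ τ a⟩

theorem subset_symOrbit {R : Type*} (A : Set (ℕ → R)) : A ⊆ symOrbit A :=
  fun a ha => ⟨1, one_mem _, a, ha, by ext; simp [permSeq]⟩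

theorem permSeq_mem_hull {A : Set (ℕ → ℝ)} {σ : Equiv.Perm ℕ} (hσ : σ ∈ SymInf) {u : ℕ → ℝ}
    (hu : u ∈ PointedCone.hull ℝ (symOrbit A)) :
    permSeq σ u ∈ PointedCone.hull ℝ (symOrbit A) := by
  induction hu using Submodule.span_induction with
  | mem x hx => exact Submodule.subset_span (permSeq_mem_symOrbit hσ hx)
  | zero => exact zero_mem _
  | add x y _ _ hx hy => exact add_mem hx hy
  | smul c x _ hx => exact Submodule.smul_mem _ c hx

/-- The transferred vector is a convex combination of `u` and its swap. -/
theorem add_transfer_mem {C : PointedCone ℝ (ℕ → ℝ)}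
    (hC : ∀ u ∈ C, ∀ i j, permSeq (Equiv.swap i j) u ∈ C) {u : ℕ → ℝ} (hu : u ∈ C) {i j : ℕ}
    {t : ℝ} (ht : 0 ≤ t) (hd : 0 < u i - u j) (htd : t ≤ u i - u j) :
    u + t • (Pi.single j (1 : ℝ) - Pi.single i 1) ∈ C := by
  have h : u + t • (Pi.single j (1 : ℝ) - Pi.single i 1) =
      (1 - t / (u i - u j)) • u + (t / (u i - u j)) • permSeq (Equiv.swap i j) u := by
    rw [permSeq_swap, smul_add, smul_smul, div_mul_cancel₀ _ hd.ne', sub_smul, one_smul]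
    abel
  rw [h]
  exact add_mem (C.smul_mem (sub_nonneg.2 ((div_le_one hd).2 htd)) hu)
    (C.smul_mem (div_nonneg ht hd.le) (hC u hu i j))

/-! ### Lattice points and normality -/

theorem mem_latticePoints {C : PointedCone ℝ (ℕ → ℝ)} {u : ℕ → ℤ} :
    u ∈ latticePoints C ↔ intSeqToReal u ∈ C ∧ (Function.support u).Finite := Iff.rfl

theorem latticePoints_iff {C : PointedCone ℝ (ℕ → ℝ)} (hfin : (C : Set (ℕ → ℝ)) ⊆ FinSuppSeq ℝ)
    {u : ℕ → ℤ} : u ∈ latticePoints C ↔ intSeqToReal u ∈ C := by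
  refine mem_latticePoints.trans ⟨fun h => h.1, fun h => ⟨h, ?_⟩⟩
  refine Set.Finite.subset (hfin h) fun i hi => ?_
  simpa [intSeqToReal] using hi

theorem monoidNormal_latticePoints {C : PointedCone ℝ (ℕ → ℝ)}
    (hfin : (C : Set (ℕ → ℝ)) ⊆ FinSuppSeq ℝ) : MonoidNormal (latticePoints C) := by
  ext u
  refine ⟨fun h => ⟨1, le_rfl, by simpa using h⟩, ?_⟩
  rintro ⟨k, hk, hku⟩
  rw [latticePoints_iff hfin, map_nsmul] at hku
  rw [SetLike.mem_coe, latticePoints_iff hfin]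
  have hk0 : (k : ℝ) ≠ 0 := by exact_mod_cast (by omega : k ≠ 0)
  have h := C.smul_mem (r := (k : ℝ)⁻¹) (by positivity) hku
  rwa [← Nat.cast_smul_eq_nsmul ℝ, smul_smul, inv_mul_cancel₀ hk0, one_smul] at h

/-! ### Generation in bounded coordinate sum -/

/-- The lattice points of `C` whose coordinate sum is at most `L`. -/
def boundedLatticePoints (C : PointedCone ℝ (ℕ → ℝ)) (L : ℕ) : Set (ℕ → ℤ) :=
  {g | g ∈ latticePoints C ∧ ∀ F : Finset ℕ, ∑ i ∈ F, g i ≤ L}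

theorem intSeqToReal_transfer (u : ℕ → ℤ) (i j : ℕ) (t : ℤ) :
    intSeqToReal (u + t • (Pi.single j (1 : ℤ) - Pi.single i 1)) =
      intSeqToReal u + (t : ℝ) • (Pi.single j (1 : ℝ) - Pi.single i 1) := by
  ext l
  simp [intSeqToReal, Pi.single_apply]

/-- If a sum is larger at `i` than at `j`, so is one of its summands; the unit is transferred within
that summand. -/
theorem transfer_mem_closure {C : PointedCone ℝ (ℕ → ℝ)}
    (hfin : (C : Set (ℕ → ℝ)) ⊆ FinSuppSeq ℝ) (hnonneg : ∀ u ∈ C, ∀ i, 0 ≤ u i)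
    (hC : ∀ u ∈ C, ∀ i j, permSeq (Equiv.swap i j) u ∈ C) {L : ℕ} {u : ℕ → ℤ}
    (hu : u ∈ AddSubmonoid.closure (boundedLatticePoints C L)) {i j : ℕ} (hij : u j < u i) :
    u + (Pi.single j (1 : ℤ) - Pi.single i 1) ∈
      AddSubmonoid.closure (boundedLatticePoints C L) := by
  induction hu using AddSubmonoid.closure_induction with
  | zero => simp at hij
  | add x y hx hy ihx ihy =>
    by_cases h : x j < x i
    · have := add_mem (ihx h) hy
      rwa [add_right_comm] at this
    · have h' : y j < y i := by
        simp only [Pi.add_apply] at hij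
        omega
      have := add_mem hx (ihy h')
      rwa [← add_assoc] at this
  | mem g hg =>
    have hgC := (latticePoints_iff hfin).1 hg.1
    have hg0 : ∀ l, 0 ≤ g l := fun l => by
      have h := hnonneg _ hgC l
      exact_mod_cast (show (0 : ℝ) ≤ (g l : ℝ) from h)
    refine AddSubmonoid.subset_closure ⟨?_, fun F => ?_⟩
    · rw [latticePoints_iff hfin]
      have h1 : (1 : ℝ) ≤ (g i : ℝ) - (g j : ℝ) := by
        exact_mod_cast (by omega : (1 : ℤ) ≤ g i - g j)
      have h := add_transfer_mem hC hgC (i := i) (j := j) zero_le_one (zero_lt_one.trans_le h1) h1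
      have h2 := intSeqToReal_transfer g i j 1
      rw [Int.cast_one] at h2
      rw [← h2, one_smul] at h
      exact h
    · have h1 := hg.2 F
      -- If `F` contains `j` but not `i`, the extra unit is paid for by `g i ≥ 1`.
      have h2 := hg.2 (insert i F)
      have h3 := hg0 j
      simp only [Pi.add_apply, Pi.sub_apply, Finset.sum_add_distrib, Finset.sum_sub_distrib,
        Pi.single_apply, Finset.sum_ite_eq']
      by_cases hi : i ∈ F
      · split_ifs <;> omega
      · rw [Finset.sum_insert hi] at h2
        split_ifs <;> omega

/-- After `c` transfers the entries are `v i - c` and `c`; another is allowed while `c < v i - c`,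
which the factor 2 guarantees. -/
theorem unmerge_mem_closure {C : PointedCone ℝ (ℕ → ℝ)}
    (hfin : (C : Set (ℕ → ℝ)) ⊆ FinSuppSeq ℝ) (hnonneg : ∀ u ∈ C, ∀ i, 0 ≤ u i)
    (hC : ∀ u ∈ C, ∀ i j, permSeq (Equiv.swap i j) u ∈ C) {L : ℕ} {v : ℕ → ℤ}
    (hv : v ∈ AddSubmonoid.closure (boundedLatticePoints C L)) {i j : ℕ} (hij : i ≠ j)
    (hvj : v j = 0) (c : ℕ) (hvi : 2 * c ≤ v i) :
    v + c • (Pi.single j (1 : ℤ) - Pi.single i 1) ∈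
      AddSubmonoid.closure (boundedLatticePoints C L) := by
  induction c with
  | zero => simpa using hv
  | succ c ih =>
    rw [succ_nsmul, ← add_assoc]
    refine transfer_mem_closure hfin hnonneg hC (ih (by push_cast at hvi; omega)) ?_
    simp [hij, hij.symm, hvj]
    push_cast at hvi
    omega

theorem mem_closure_of_card_support_le {S : Set (ℕ → ℝ)} {m : ℕ} (hS : BoundedNatVectors S m)
    (hfin : (PointedCone.hull ℝ S : Set (ℕ → ℝ)) ⊆ FinSuppSeq ℝ) (K : ℕ) {u : ℕ → ℤ}
    (hu : u ∈ latticePoints (PointedCone.hull ℝ S)) (F : Finset ℕ) (huF : ∀ l, l ∉ F → u l = 0)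
    (hF : F.card ≤ K) :
    u ∈ AddSubmonoid.closure
      (boundedLatticePoints (PointedCone.hull ℝ S) (m * (m + 1) ^ K)) := by
  rw [latticePoints_iff hfin] at hu
  obtain ⟨T, lam, hT, hlam, hsum⟩ := PointedCone.mem_hull_iff_exists_finset.1 hu
  set T' := T.filter fun x => lam x ≠ 0 with hT'def
  have hT' : ∀ x ∈ T', x ∈ S := fun x hx => hT x (Finset.mem_filter.1 hx).1
  have hsum' : ∑ x ∈ T', lam x • x = intSeqToReal u := by
    rw [← hsum, hT'def, Finset.sum_filter]
    refine Finset.sum_congr rfl fun x _ => ?_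
    by_cases h : lam x = 0 <;> simp [h]
  have hsupp : ∀ x ∈ T', ∀ l, l ∉ F → x l = 0 := by
    intro x hx l hl
    have h1 : ∑ y ∈ T', lam y * y l = 0 := by
      have := congrFun hsum' l
      rw [Finset.sum_apply] at this
      have h2 : intSeqToReal u l = ((u l : ℤ) : ℝ) := rfl
      rw [h2, huF l hl, Int.cast_zero] at this
      exact this
    have h2 := (Finset.sum_eq_zero_iff_of_nonneg fun y hy =>
      mul_nonneg (hlam y) (hS.nonneg (hT' y hy) l)).1 h1 x hx
    exact (mul_eq_zero.1 h2).resolve_left (Finset.mem_filter.1 hx).2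
  have hfloor : ∀ x ∈ S, ∀ l, ((⌊x l⌋₊ : ℕ) : ℝ) = x l := by
    intro x hx l
    obtain ⟨n, hn⟩ := hS.nat x hx l
    simp [hn]
  -- The generators in use live on `F` with entries in `{0, ..., m}`.
  have hcard : T'.card ≤ (m + 1) ^ K := by
    have h1 : T'.card ≤ (Fintype.piFinset fun _ : F => Finset.range (m + 1)).card := by
      refine Finset.card_le_card_of_injOn (fun x l => ⌊x l⌋₊) ?_ ?_
      · intro x hx
        simp only [Finset.mem_coe, Fintype.mem_piFinset, Finset.mem_range]
        intro l
        have h := hS.sum_le x (hT' x hx) {(l : ℕ)}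
        rw [Finset.sum_singleton, ← hfloor x (hT' x hx) l] at h
        exact Nat.lt_succ_of_le (by exact_mod_cast h)
      · intro x hx y hy hxy
        ext l
        by_cases hl : l ∈ F
        · rw [← hfloor x (hT' x hx) l, ← hfloor y (hT' y hy) l]
          exact congrArg _ (congrFun hxy ⟨l, hl⟩)
        · rw [hsupp x hx l hl, hsupp y hy l hl]
    refine h1.trans ?_
    simp only [Fintype.card_piFinset, Finset.card_range, Finset.prod_const, Finset.card_univ,
      Fintype.card_coe]
    exact Nat.pow_le_pow_right (Nat.succ_pos m) hF
  set z : (ℕ → ℝ) → ℕ → ℤ := fun x l => (⌊x l⌋₊ : ℤ) with hz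
  have hzx : ∀ x ∈ S, intSeqToReal (z x) = x := fun x hx => by
    ext l
    rw [← hfloor x hx l]
    simp [intSeqToReal, hz]
  -- The fractional remainder: a lattice point of coordinate sum at most `m` times the number of
  -- generators.
  set w : ℕ → ℤ := u - ∑ x ∈ T', ⌊lam x⌋₊ • z x with hw
  have hwreal : intSeqToReal w = ∑ x ∈ T', (lam x - ⌊lam x⌋₊) • x := by
    rw [hw, map_sub, ← hsum', map_sum, ← Finset.sum_sub_distrib]
    refine Finset.sum_congr rfl fun x hx => ?_
    rw [map_nsmul, hzx x (hT' x hx), sub_smul, Nat.cast_smul_eq_nsmul]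
  have hfr0 : ∀ x, 0 ≤ lam x - ⌊lam x⌋₊ := fun x => sub_nonneg.2 (Nat.floor_le (hlam x))
  have hfr1 : ∀ x, lam x - ⌊lam x⌋₊ ≤ 1 := fun x => by
    have := Nat.lt_floor_add_one (lam x)
    linarith
  have hzmem : ∀ x ∈ T', z x ∈ boundedLatticePoints (PointedCone.hull ℝ S) (m * (m + 1) ^ K) := by
    refine fun x hx => ⟨(latticePoints_iff hfin).2 ?_, fun E => ?_⟩
    · rw [hzx x (hT' x hx)]
      exact Submodule.subset_span (hT' x hx)
    · have h1 : ((∑ l ∈ E, z x l : ℤ) : ℝ) ≤ m := by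
        refine le_of_eq_of_le ?_ (hS.sum_le x (hT' x hx) E)
        push_cast
        exact Finset.sum_congr rfl fun l _ => by rw [← hfloor x (hT' x hx) l]; simp [hz]
      have h2 : ∑ l ∈ E, z x l ≤ (m : ℤ) := by exact_mod_cast h1
      refine h2.trans ?_
      exact_mod_cast Nat.le_mul_of_pos_right m (by positivity)
  have hwmem : w ∈ boundedLatticePoints (PointedCone.hull ℝ S) (m * (m + 1) ^ K) := by
    refine ⟨(latticePoints_iff hfin).2 ?_, fun E => ?_⟩
    · rw [hwreal]
      exact sum_mem fun x hx => (PointedCone.hull ℝ S).smul_mem (hfr0 x)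
        (Submodule.subset_span (hT' x hx))
    · have h1 : ((∑ l ∈ E, w l : ℤ) : ℝ) ≤ m * (m + 1) ^ K := by
        calc ((∑ l ∈ E, w l : ℤ) : ℝ) = ∑ l ∈ E, intSeqToReal w l := by push_cast; rfl
          _ = ∑ x ∈ T', (lam x - ⌊lam x⌋₊) * ∑ l ∈ E, x l := by
            simp only [hwreal, Finset.sum_apply, Pi.smul_apply, smul_eq_mul]
            rw [Finset.sum_comm]
            simp only [Finset.mul_sum]
          _ ≤ ∑ x ∈ T', (m : ℝ) := Finset.sum_le_sum fun x hx =>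
            (mul_le_of_le_one_left (Finset.sum_nonneg fun l _ => hS.nonneg (hT' x hx) l)
              (hfr1 x)).trans (hS.sum_le x (hT' x hx) E)
          _ ≤ m * (m + 1) ^ K := by
            rw [Finset.sum_const, nsmul_eq_mul, mul_comm]
            exact mul_le_mul_of_nonneg_left (by exact_mod_cast hcard) (Nat.cast_nonneg m)
      exact_mod_cast h1
  have hdecomp : u = w + ∑ x ∈ T', ⌊lam x⌋₊ • z x := by rw [hw, sub_add_cancel]
  rw [hdecomp]
  exact add_mem (AddSubmonoid.subset_closure hwmem)
    (sum_mem fun x hx => nsmul_mem (AddSubmonoid.subset_closure (hzmem x hx)) _)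

theorem latticePoints_le_closure {S : Set (ℕ → ℝ)} {m : ℕ} (hS : BoundedNatVectors S m)
    (hfin : (PointedCone.hull ℝ S : Set (ℕ → ℝ)) ⊆ FinSuppSeq ℝ)
    (hnonneg : ∀ u ∈ PointedCone.hull ℝ S, ∀ i, 0 ≤ u i)
    (hC : ∀ u ∈ PointedCone.hull ℝ S, ∀ i j,
      permSeq (Equiv.swap i j) u ∈ PointedCone.hull ℝ S) :
    latticePoints (PointedCone.hull ℝ S) ≤ AddSubmonoid.closure
      (boundedLatticePoints (PointedCone.hull ℝ S) (m * (m + 1) ^ (7 * m))) := by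
  have key : ∀ (F : Finset ℕ) (u : ℕ → ℤ), u ∈ latticePoints (PointedCone.hull ℝ S) →
      (∀ l, l ∈ F ↔ u l ≠ 0) → u ∈ AddSubmonoid.closure
        (boundedLatticePoints (PointedCone.hull ℝ S) (m * (m + 1) ^ (7 * m))) := by
    intro F
    induction F using Finset.strongInduction with
    | H F ih =>
      intro u hu huF
      by_cases hF : F.card ≤ 7 * m
      · exact mem_closure_of_card_support_le hS hfin _ hu F
          (fun l hl => by simpa using (huF l).not.1 hl) hF
      have huC := (latticePoints_iff hfin).1 hu
      have hu0 : ∀ l, 0 ≤ u l := fun l => by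
        exact_mod_cast (show (0 : ℝ) ≤ (u l : ℝ) from hnonneg _ huC l)
      have hupos : ∀ l ∈ F, 0 < u l := fun l hl => lt_of_le_of_ne (hu0 l) ((huF l).1 hl).symm
      have hmove : ∀ x ∈ S, ∀ i j, x i = 0 →
          x + x j • (Pi.single i (1 : ℝ) - Pi.single j 1) ∈ PointedCone.hull ℝ S := by
        intro x hx i j hxi
        have h := hC x (Submodule.subset_span hx) j i
        rwa [permSeq_swap, hxi, sub_zero] at h
      obtain ⟨i, hi, j, hj, hij, hle, hmem⟩ := exists_merge_mem_hull hS hmove huC F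
        (fun l hl => Int.cast_pos.2 (hupos l hl)) (not_le.1 hF)
      have hle' : u j ≤ u i := by exact_mod_cast (show (u j : ℝ) ≤ (u i : ℝ) from hle)
      set v : ℕ → ℤ := u + u j • (Pi.single i (1 : ℤ) - Pi.single j 1) with hv
      have hvC : v ∈ latticePoints (PointedCone.hull ℝ S) := by
        rw [latticePoints_iff hfin, hv, intSeqToReal_transfer]
        exact hmem
      have hvj : v j = 0 := by simp [hv, hij.symm]
      have hvi : v i = u i + u j := by simp [hv, hij]
      have hvF : ∀ l, l ∈ F.erase j ↔ v l ≠ 0 := by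
        intro l
        have h1 := hupos i hi
        have h2 := hupos j hj
        by_cases hlj : l = j
        · simp [hlj, hvj]
        by_cases hli : l = i
        · subst hli
          simp only [hvi, Finset.mem_erase, ne_eq, hlj, not_false_eq_true, hi, and_self, true_iff]
          omega
        · have h3 : v l = u l := by simp [hv, hlj, hli]
          rw [h3, Finset.mem_erase, huF]
          simp [hlj]
      have hvcl := ih _ (Finset.erase_ssubset hj) v hvC hvF
      have h := unmerge_mem_closure hfin hnonneg hC hvcl hij hvj (u j).toNat
        (by rw [hvi]; have := hupos j hj; omega)
      have huv : u = v + (u j).toNat • (Pi.single j (1 : ℤ) - Pi.single i 1) := by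
        rw [← natCast_zsmul, Int.toNat_of_nonneg (hu0 j), hv, add_assoc, ← smul_add]
        simp
      rwa [← huv] at h
  intro u hu
  exact key (Set.Finite.toFinset hu.2) u hu fun l => Set.Finite.mem_toFinset hu.2

/-! ### Finitely many orbits of bounded lattice points -/

theorem exists_symInf_apply_lt_card (F : Finset ℕ) : ∃ σ ∈ SymInf, ∀ i ∈ F, σ i < F.card := by
  induction F using Finset.induction_on with
  | empty => exact ⟨1, one_mem _, by simp⟩
  | insert a F ha ih =>
    obtain ⟨σ, hσ, h⟩ := ih
    refine ⟨Equiv.swap (σ a) F.card * σ, mul_mem (swap_mem_symInf _ _) hσ, fun i hi => ?_⟩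
    rw [Finset.card_insert_of_notMem ha, Equiv.Perm.mul_apply]
    rcases Finset.mem_insert.1 hi with rfl | hi
    · simp
    · have h1 : σ i ≠ σ a := fun h => ha (σ.injective h ▸ hi)
      rw [Equiv.swap_apply_of_ne_of_ne h1 (h i hi).ne]
      exact (h i hi).trans (Nat.lt_succ_self _)

theorem sum_permSeq {R : Type*} [AddCommMonoid R] (σ : Equiv.Perm ℕ) (u : ℕ → R)
    (F : Finset ℕ) : ∑ i ∈ F, permSeq σ u i = ∑ i ∈ F.map (σ⁻¹).toEmbedding, u i := by
  rw [Finset.sum_map]; rfl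

theorem monoidSymFG_latticePoints {C : PointedCone ℝ (ℕ → ℝ)}
    (hfin : (C : Set (ℕ → ℝ)) ⊆ FinSuppSeq ℝ) (hnonneg : ∀ u ∈ C, ∀ i, 0 ≤ u i)
    (hC : ∀ σ ∈ SymInf, ∀ u ∈ C, permSeq σ u ∈ C) (L : ℕ)
    (hL : latticePoints C ≤ AddSubmonoid.closure (boundedLatticePoints C L)) :
    MonoidSymFG (latticePoints C) := by
  have hperm : ∀ σ ∈ SymInf, ∀ u ∈ latticePoints C, permSeq σ u ∈ latticePoints C := by
    intro σ hσ u hu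
    rw [latticePoints_iff hfin] at hu ⊢
    exact hC σ hσ _ hu
  have hpos : ∀ u ∈ latticePoints C, ∀ l, 0 ≤ u l := fun u hu l => by
    exact_mod_cast (show (0 : ℝ) ≤ (u l : ℝ) from hnonneg _ ((latticePoints_iff hfin).1 hu) l)
  refine ⟨{g | g ∈ boundedLatticePoints C L ∧ ∀ l, L ≤ l → g l = 0}, ?_, ?_, le_antisymm ?_ ?_⟩
  · refine (Set.finite_range fun (w : Fin L → Fin (L + 1)) (l : ℕ) =>
      if h : l < L then ((w ⟨l, h⟩ : ℕ) : ℤ) else 0).subset ?_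
    rintro g ⟨⟨hg, hgL⟩, hg0⟩
    have hle : ∀ l, g l ≤ L := fun l => by simpa using hgL {l}
    refine ⟨fun l => ⟨(g l).toNat, by have := hle l; omega⟩, ?_⟩
    ext l
    by_cases h : l < L
    · simp [h, hpos g hg l]
    · simp [h, hg0 l (not_lt.1 h)]
  · exact fun g hg => hg.1.1.2
  · refine hL.trans (AddSubmonoid.closure_mono ?_)
    rintro g ⟨hg, hgL⟩
    obtain ⟨σ, hσ, hlt⟩ := exists_symInf_apply_lt_card hg.2.toFinset
    -- Nonzero entries are at least 1, so the support fits into the first `L` positions.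
    have hcard : hg.2.toFinset.card ≤ L := by
      have h1 : ∑ _i ∈ hg.2.toFinset, (1 : ℤ) ≤ L := by
        refine (Finset.sum_le_sum fun i hi => ?_).trans (hgL hg.2.toFinset)
        have h2 : g i ≠ 0 := (Set.Finite.mem_toFinset hg.2).1 hi
        have := hpos g hg i
        omega
      simpa using h1
    refine ⟨σ⁻¹, inv_mem hσ, permSeq σ g, ⟨⟨hperm σ hσ g hg, fun F => ?_⟩, fun l hl => ?_⟩, ?_⟩
    · rw [sum_permSeq]
      exact hgL _
    · by_contra h
      have := hlt (σ⁻¹ l) ((Set.Finite.mem_toFinset hg.2).2 h)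
      rw [← Equiv.Perm.mul_apply, mul_inv_cancel, Equiv.Perm.one_apply] at this
      omega
    · rw [permSeq_permSeq, inv_mul_cancel]
      rfl
  · rw [AddSubmonoid.closure_le]
    rintro _ ⟨σ, hσ, g, hg, rfl⟩
    exact hperm σ hσ g hg.1.1

/-! ### Integral generators -/

theorem exists_nat_smul_eq_intSeqToReal {b : ℕ → ℝ} (hb : b ∈ FinSuppSeq ℝ)
    (hq : ∀ i, ∃ q : ℚ, b i = q) :
    ∃ (N : ℕ) (z : ℕ → ℤ), 0 < N ∧ intSeqToReal z = (N : ℝ) • b := by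
  choose q hq using hq
  have hb' : (Function.support b).Finite := hb
  have hz : ∀ i, ∃ z : ℤ, (z : ℝ) = (∏ l ∈ hb'.toFinset, (q l).den : ℕ) * b i := by
    intro i
    by_cases hi : b i = 0
    · exact ⟨0, by simp [hi]⟩
    obtain ⟨k, hk⟩ := Finset.dvd_prod_of_mem (fun l => (q l).den) (hb'.mem_toFinset.2 hi)
    refine ⟨(k : ℤ) * (q i).num, ?_⟩
    rw [hk, hq i]
    have h : ((k : ℤ) * (q i).num : ℚ) = ((q i).den * k : ℕ) * q i := by
      push_cast
      rw [mul_right_comm, Rat.den_mul_eq_num, mul_comm]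
    exact_mod_cast h
  choose z hz using hz
  exact ⟨_, z, Finset.prod_pos fun l _ => (q l).den_pos, funext hz⟩

/-- The finite set `A` may be irrational and the rational set `B` infinite; but each `a ∈ A` needs
only finitely many elements of `B`, and these can be scaled to integers. -/
theorem exists_integral_generators {C : PointedCone ℝ (ℕ → ℝ)}
    (hfin : (C : Set (ℕ → ℝ)) ⊆ FinSuppSeq ℝ) (hfg : ConeSymFG C) (hrat : ConeRational C) :
    ∃ Z : Set (ℕ → ℤ), Z.Finite ∧ C = PointedCone.hull ℝ (symOrbit (intSeqToReal '' Z)) := by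
  obtain ⟨A, hA, -, hCA⟩ := hfg
  obtain ⟨B, hB, hCB⟩ := hrat
  have hBC : B ⊆ C := by rw [hCB]; exact Submodule.subset_span
  have hT : ∀ a : ℕ → ℝ, ∃ T : Finset (ℕ → ℝ), a ∈ A →
      ↑T ⊆ B ∧ a ∈ PointedCone.hull ℝ (T : Set (ℕ → ℝ)) := by
    intro a
    by_cases ha : a ∈ A
    · have haC : a ∈ C := by rw [hCA]; exact Submodule.subset_span (subset_symOrbit A ha)
      rw [hCB] at haC
      obtain ⟨T, hT⟩ := Submodule.mem_span_finite_of_mem_span haC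
      exact ⟨T, fun _ => hT⟩
    · exact ⟨∅, fun h => absurd h ha⟩
  choose T hT using hT
  have hz : ∀ b : ℕ → ℝ, ∃ (N : ℕ) (z : ℕ → ℤ), b ∈ B →
      0 < N ∧ intSeqToReal z = (N : ℝ) • b := by
    intro b
    by_cases hb : b ∈ B
    · obtain ⟨N, z, h⟩ := exists_nat_smul_eq_intSeqToReal (hfin (hBC hb)) (hB b hb)
      exact ⟨N, z, fun _ => h⟩
    · exact ⟨0, 0, fun h => absurd h hb⟩
  choose N z hz using hz
  refine ⟨⋃ a ∈ A, z '' (T a : Set (ℕ → ℝ)),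
    hA.biUnion fun a _ => (T a).finite_toSet.image z, le_antisymm ?_ ?_⟩
  · nth_rewrite 1 [hCA]
    refine Submodule.span_le.2 ?_
    rintro _ ⟨σ, hσ, a, ha, rfl⟩
    refine permSeq_mem_hull hσ (Submodule.span_le.2 ?_ (hT a ha).2)
    intro b hb
    obtain ⟨hN, hzb⟩ := hz b ((hT a ha).1 hb)
    have hN0 : (N b : ℝ) ≠ 0 := by exact_mod_cast hN.ne'
    have hb' : b = (N b : ℝ)⁻¹ • intSeqToReal (z b) := by
      rw [hzb, smul_smul, inv_mul_cancel₀ hN0, one_smul]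
    have hmem : intSeqToReal (z b) ∈ PointedCone.hull ℝ
        (symOrbit (intSeqToReal '' ⋃ a ∈ A, z '' (T a : Set (ℕ → ℝ)))) :=
      Submodule.subset_span (subset_symOrbit _ ⟨z b, Set.mem_biUnion ha ⟨b, hb, rfl⟩, rfl⟩)
    rw [hb']
    exact PointedCone.smul_mem _ (inv_nonneg.2 (Nat.cast_nonneg _)) hmem
  · refine Submodule.span_le.2 ?_
    rintro _ ⟨σ, hσ, _, ⟨y, hy, rfl⟩, rfl⟩
    obtain ⟨a, ha, b, hb, rfl⟩ := Set.mem_iUnion₂.1 hy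
    obtain ⟨-, hzb⟩ := hz b ((hT a ha).1 hb)
    have hmem : intSeqToReal (z b) ∈ C := by
      rw [hzb]
      exact C.smul_mem (Nat.cast_nonneg _) (hBC ((hT a ha).1 hb))
    rw [hCA] at hmem ⊢
    exact permSeq_mem_hull hσ hmem

theorem exists_boundedNatVectors_symOrbit {Z : Set (ℕ → ℤ)} (hZ : Z.Finite)
    (hfin : ∀ z ∈ Z, (Function.support z).Finite) (hpos : ∀ z ∈ Z, ∀ i, 0 ≤ z i) :
    ∃ m, BoundedNatVectors (symOrbit (intSeqToReal '' Z)) m := by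
  have hb : ∀ z : ℕ → ℤ, ∃ n : ℕ, z ∈ Z → ∀ F : Finset ℕ, ∑ i ∈ F, z i ≤ n := by
    intro z
    by_cases hz : z ∈ Z
    · refine ⟨(∑ i ∈ (hfin z hz).toFinset, z i).toNat, fun _ F => ?_⟩
      rw [Int.toNat_of_nonneg (Finset.sum_nonneg fun i _ => hpos z hz i)]
      rw [← Finset.sum_filter_ne_zero]
      refine Finset.sum_le_sum_of_subset_of_nonneg (fun i hi => ?_) fun i _ _ => hpos z hz i
      exact (hfin z hz).mem_toFinset.2 (Finset.mem_filter.1 hi).2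
    · exact ⟨0, fun h => absurd h hz⟩
  choose n hn using hb
  refine ⟨∑ z ∈ hZ.toFinset, n z, ?_, ?_⟩
  · rintro _ ⟨σ, -, _, ⟨z, hz, rfl⟩, rfl⟩ i
    refine ⟨(z (σ⁻¹ i)).toNat, ?_⟩
    have h : (((z (σ⁻¹ i)).toNat : ℤ) : ℝ) = (z (σ⁻¹ i) : ℝ) := by
      rw [Int.toNat_of_nonneg (hpos z hz _)]
    rw [← Int.cast_natCast, h]
    rfl
  · rintro _ ⟨σ, -, _, ⟨z, hz, rfl⟩, rfl⟩ F
    rw [sum_permSeq]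
    have h1 := hn z hz (F.map (σ⁻¹).toEmbedding)
    have h2 : n z ≤ ∑ z ∈ hZ.toFinset, n z :=
      Finset.single_le_sum (fun _ _ => Nat.zero_le _) (hZ.mem_toFinset.2 hz)
    have h3 : ∑ i ∈ F.map (σ⁻¹).toEmbedding, z i ≤ ((∑ z ∈ hZ.toFinset, n z : ℕ) : ℤ) :=
      h1.trans (by exact_mod_cast h2)
    have h4 : ((∑ i ∈ F.map (σ⁻¹).toEmbedding, z i : ℤ) : ℝ) ≤
        ((∑ z ∈ hZ.toFinset, n z : ℕ) : ℝ) := by exact_mod_cast h3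
    rw [Int.cast_sum] at h4
    exact h4

theorem mainTheorem1 (C : PointedCone ℝ (ℕ → ℝ))
    (hfin : (C : Set (ℕ → ℝ)) ⊆ FinSuppSeq ℝ)
    (hnonneg : ∀ u ∈ C, ∀ i, 0 ≤ u i)
    (hfg : ConeSymFG C) (hrat : ConeRational C) :
    MonoidNormal (latticePoints C) ∧ MonoidSymFG (latticePoints C) := by
  refine ⟨monoidNormal_latticePoints hfin, ?_⟩
  obtain ⟨Z, hZ, rfl⟩ := exists_integral_generators hfin hfg hrat
  have hZC : ∀ z ∈ Z, z ∈ latticePoints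
      (PointedCone.hull ℝ (symOrbit (intSeqToReal '' Z))) := fun z hz =>
    (latticePoints_iff hfin).2 (Submodule.subset_span (subset_symOrbit _ ⟨z, hz, rfl⟩))
  obtain ⟨m, hm⟩ := exists_boundedNatVectors_symOrbit hZ (fun z hz => (hZC z hz).2)
    fun z hz i => by
      exact_mod_cast (show (0 : ℝ) ≤ (z i : ℝ) from hnonneg _ (hZC z hz).1 i)
  exact monoidSymFG_latticePoints hfin hnonneg (fun σ hσ u hu => permSeq_mem_hull hσ hu) _
    (latticePoints_le_closure hm hfin hnonneg fun u hu i j =>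
      permSeq_mem_hull (swap_mem_symInf i j) hu)
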